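/- Let $d\ge 1$ and let $\mathcal K$ be an orthogonal projection on the complex Hilbert space $L^2(\mathbb R^d,dx)$. For a bounded Borel set $\Lambda\subset\mathbb R^d$ let $\mathcal P_\Lambda f=\mathbf 1_\Lambda f$, $\mathcal M_\Lambda=\mathcal P_\Lambda\mathcal K\mathcal P_\Lambda$ and $\mathcal N_\Lambda=\mathcal K\mathcal P_\Lambda$. Assume that $\mathcal K$ is locally trace class, i.e. $\mathcal M_\Lambda$ is trace class for every bounded Borel $\Lambda$. Let $K$ be the kernel of $\mathcal K$: a measurable function with $K(x,\cdot)\in L^2(\mathbb R^d)$ for almost all $x$, with $\mathcal Kf(x)=\int K(x,y)f(y)\,dy$ for every $f\in L^2(\mathbb R^d)$ and almost all $x$, and whose values on the diagonal are those given by the reproducing property, $K(x,x)=\int K(x,y)K(y,x)\,dy$ for almost all $x$. Assume that the determinantal point process with correlation kernel $K$ is radial and normalized: there is $\varphi:[0,\infty)\to[0,\infty)$ with $|K(x,y)|^2=\varphi(\|x-y\|)$ for almost all $(x,y)$, and $K(x,x)=1$ for almost all $x$. For a bounded Borel set $\Lambda$ let $\mathcal M_\Lambda=\sum_{j\ge1}\mu_j^{(\Lambda)}\,\Phi_j^{(\Lambda)}\otimes\Phi_j^{(\Lambda)}$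 be a spectral decomposition, with $(\Phi_j^{(\Lambda)})_{j\ge1}$ orthonormal and $\mu_1^{(\Lambda)}\ge\mu_2^{(\Lambda)}\ge\dots\ge0$; let $\mathcal N_\Lambda=\mathcal W_\Lambda\sqrt{\mathcal M_\Lambda}$ be the polar decomposition, where $\mathcal W_\Lambda$ is a partial isometry that vanishes on $\ker\mathcal M_\Lambda$; and define the accumulated spectrogram $$\rho_\Lambda(x)=\sum_{j=1}^{N_\Lambda}\bigl|(\mathcal W_\Lambda\Phi_j^{(\Lambda)})(x)\bigr|^2,\qquad N_\Lambda=\lceil\operatorname{Tr}\mathcal M_\Lambda\rceil .$$ Then for every relatively compact open set $\Lambda\subset\mathbb R^d$, and for every choice of the spectral decompositions of the operators $\mathcal M_{R\Lambda}$, $R>0$, the functions $\rho_{R\Lambda}(R\,\cdot)$ belong to $L^1(\mathbb R^d,dx)$ and $$\rho_{R\Lambda}(R\,\cdot)\longrightarrow\mathbf 1_\Lambda\quad\text{in }L^1(\mathbb R^d,dx)\text{ as }R\to+\infty .$$ -/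

import Mathlib

open MeasureTheory Filter Topology
open scoped NNReal ENNReal Pointwise InnerProductSpace

noncomputable section

/-! Trace class operators, spectral decomposition, polar decomposition on a Hilbert space. -/

section HilbertSpace

universe u

variable {H : Type u} [NormedAddCommGroup H] [InnerProductSpace ℂ H] [CompleteSpace H]

/-- The positive square root of a positive operator. -/
def opSqrt (T : H →L[ℂ] H) : H →L[ℂ] H := CFC.sqrt T

/-- The absolute value `|T| = √(T* T)`. -/
def opAbs (T : H →L[ℂ] H) : H →L[ℂ] H := opSqrt (star T * T)

theorem opAbs_eq (T : H →L[ℂ] H) : opAbs T = CFC.abs T := rfl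

/-- `T` is trace class: the diagonal sum of `|T| = √(T* T)` is finite in every orthonormal
(Hilbert) basis. (Bases of `H : Type u` are indexed by types in `Type u`, and one exists.) -/
def IsTraceClass (T : H →L[ℂ] H) : Prop :=
  ∀ (ι : Type u) (b : HilbertBasis ι ℂ H),
    Summable fun i => RCLike.re ⟪b i, opAbs T (b i)⟫_ℂ

variable (H) in
/-- A set of vectors of `H` that underlies an orthonormal basis. -/
def basisSet : Set H := (exists_hilbertBasis ℂ H).choose

variable (H) in
/-- An orthonormal basis of `H`. -/
def someHilbertBasis : HilbertBasis (basisSet H) ℂ H :=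
  (exists_hilbertBasis ℂ H).choose_spec.choose

/-- The trace `Tr T = ∑ ⟨T e_i, e_i⟩` over an orthonormal basis; for a trace class operator
the sum converges absolutely and does not depend on the basis. -/
def opTrace (T : H →L[ℂ] H) : ℂ :=
  ∑' i : basisSet H, ⟪someHilbertBasis H i, T (someHilbertBasis H i)⟫_ℂ

/-- `T = ∑_j μ_j Φ_j ⊗ Φ_j` with `(Φ_j)` orthonormal and `μ_0 ≥ μ_1 ≥ ... ≥ 0`:
a spectral decomposition of a positive compact operator, with eigenvalues in non-increasing
order, repeated according to multiplicity. -/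
structure IsSpectralDecomposition (T : H →L[ℂ] H) (μ : ℕ → ℝ) (Φ : ℕ → H) : Prop where
  orthonormal : Orthonormal ℂ Φ
  antitone : Antitone μ
  nonneg : ∀ j, 0 ≤ μ j
  hasSum : ∀ f : H, HasSum (fun j => ((μ j : ℂ) * ⟪Φ j, f⟫_ℂ) • Φ j) (T f)

/-- The closure of the range of `|N| = √(N* N)`. -/
def absRange (N : H →L[ℂ] H) : Submodule ℂ H :=
  (LinearMap.range (opAbs N).toLinearMap).topologicalClosure

theorem absRange_isClosed (N : H →L[ℂ] H) : IsClosed (absRange N : Set H) :=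
  Submodule.isClosed_topologicalClosure _

instance absRange_completeSpace (N : H →L[ℂ] H) : CompleteSpace (absRange N) :=
  (absRange_isClosed N).completeSpace_coe

/-- `|N|` as a map into the closure of its range. -/
def absCodRestrict (N : H →L[ℂ] H) : H →L[ℂ] absRange N :=
  (opAbs N).codRestrict (absRange N)
    fun x => Submodule.le_topologicalClosure _ (LinearMap.mem_range_self _ x)

/-- The partial isometry `W` of the polar decomposition `N = W |N|`: the continuous extension
of `|N| f ↦ N f` to the closure of the range of `|N|`, and `0` on the orthogonal complement. -/
def polarFactor (N : H →L[ℂ] H) : H →L[ℂ] H :=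
  (LinearMap.extendOfNorm N.toLinearMap (absCodRestrict N).toLinearMap).comp
    (absRange N).orthogonalProjectionOnto

theorem norm_abs_apply (N : H →L[ℂ] H) (f : H) : ‖opAbs N f‖ = ‖N f‖ := by
  have hsa : star (opAbs N) = opAbs N :=
    (CFC.abs_nonneg N).isSelfAdjoint
  have h1 : ⟪opAbs N f, opAbs N f⟫_ℂ = ⟪N f, N f⟫_ℂ := by
    have h2 : (star (opAbs N) * opAbs N) f = (star N * N) f := by
      rw [hsa, opAbs_eq, CFC.abs_mul_abs]
    calc ⟪opAbs N f, opAbs N f⟫_ℂ = ⟪f, (star (opAbs N) * opAbs N) f⟫_ℂ := by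
          rw [ContinuousLinearMap.star_eq_adjoint, mul_apply_eq_comp,
            ContinuousLinearMap.adjoint_inner_right]
      _ = ⟪N f, N f⟫_ℂ := by
          rw [h2, ContinuousLinearMap.star_eq_adjoint, mul_apply_eq_comp,
            ContinuousLinearMap.adjoint_inner_right]
  rw [inner_self_eq_norm_sq_to_K, inner_self_eq_norm_sq_to_K] at h1
  have h3 : ‖opAbs N f‖ ^ 2 = ‖N f‖ ^ 2 := by exact_mod_cast h1
  exact (sq_eq_sq₀ (norm_nonneg _) (norm_nonneg _)).1 h3

theorem absCodRestrict_denseRange (N : H →L[ℂ] H) : DenseRange (absCodRestrict N) := by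
  intro y
  rw [closure_subtype]
  have hy : (y : H) ∈ closure (Set.range (fun x => opAbs N x)) := y.2
  refine closure_mono ?_ hy
  rintro _ ⟨x, rfl⟩
  exact ⟨absCodRestrict N x, ⟨x, rfl⟩, rfl⟩

theorem polarFactor_abs_apply (N : H →L[ℂ] H) (f : H) :
    polarFactor N (opAbs N f) = N f := by
  have h1 : (absRange N).orthogonalProjectionOnto (opAbs N f) = absCodRestrict N f :=
    Submodule.orthogonalProjectionOnto_mem_subspace_eq_self (absCodRestrict N f)
  have h2 := LinearMap.extendOfNorm_eq (f := N.toLinearMap) (e := (absCodRestrict N).toLinearMap)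
    (absCodRestrict_denseRange N) ⟨1, fun x => by
      have : ‖absCodRestrict N x‖ = ‖opAbs N x‖ := rfl
      simp [this, norm_abs_apply]⟩ f
  rw [polarFactor, ContinuousLinearMap.comp_apply, h1]
  exact h2

theorem polarFactor_eq_zero (N : H →L[ℂ] H) (g : H) (hg : N g = 0) : polarFactor N g = 0 := by
  have habs : opAbs N g = 0 := by
    rw [← norm_eq_zero, norm_abs_apply, hg, norm_zero]
  have hsa : star (opAbs N) = opAbs N :=
    (CFC.abs_nonneg N).isSelfAdjoint
  have hmem : g ∈ (absRange N)ᗮ := by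
    rw [absRange, Submodule.orthogonal_closure]
    rw [Submodule.mem_orthogonal]
    rintro _ ⟨x, rfl⟩
    change ⟪opAbs N x, g⟫_ℂ = 0
    rw [← ContinuousLinearMap.adjoint_inner_right, ← ContinuousLinearMap.star_eq_adjoint, hsa,
      habs, inner_zero_right]
  rw [polarFactor, ContinuousLinearMap.comp_apply,
    Submodule.orthogonalProjectionOnto_apply_of_mem_orthogonal hmem, map_zero]

end HilbertSpace

/-! Localization operators and accumulated spectrograms on `ℝ^d`. -/

/-- `L²(ℝ^d, dx)`, complex valued. -/
abbrev L2 (d : ℕ) : Type := Lp ℂ 2 (volume : Measure (EuclideanSpace ℝ (Fin d)))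

section Localization

variable {d : ℕ}

/-- The class of `1_Λ f` in `L²`, for a measurable set `Λ`. -/
def indicatorL2 {Λ : Set (EuclideanSpace ℝ (Fin d))} (hΛ : MeasurableSet Λ) (f : L2 d) : L2 d :=
  ((Lp.memLp f).indicator hΛ).toLp (Λ.indicator f)

theorem indicatorL2_coeFn {Λ : Set (EuclideanSpace ℝ (Fin d))} (hΛ : MeasurableSet Λ) (f : L2 d) :
    indicatorL2 hΛ f =ᵐ[volume] Λ.indicator f :=
  MemLp.coeFn_toLp _

open Classical in
/-- The restriction operator `P_Λ f = 1_Λ f` of a measurable set `Λ` (`0` if `Λ` is not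
measurable, a case that is not used). -/
def restrictOp (Λ : Set (EuclideanSpace ℝ (Fin d))) : L2 d →L[ℂ] L2 d :=
  if hΛ : MeasurableSet Λ then
    LinearMap.mkContinuous
      { toFun := indicatorL2 hΛ
        map_add' := by
          intro f g
          apply Lp.ext
          filter_upwards [indicatorL2_coeFn hΛ (f + g), indicatorL2_coeFn hΛ f,
            indicatorL2_coeFn hΛ g, Lp.coeFn_add f g,
            Lp.coeFn_add (indicatorL2 hΛ f) (indicatorL2 hΛ g)] with x h1 h2 h3 h4 h5
          rw [h1, h5, Pi.add_apply, h2, h3]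
          by_cases hx : x ∈ Λ
          · rw [Set.indicator_of_mem hx, Set.indicator_of_mem hx, Set.indicator_of_mem hx, h4,
              Pi.add_apply]
          · simp [hx]
        map_smul' := by
          intro c f
          apply Lp.ext
          filter_upwards [indicatorL2_coeFn hΛ (c • f), indicatorL2_coeFn hΛ f,
            Lp.coeFn_smul c f, Lp.coeFn_smul c (indicatorL2 hΛ f)] with x h1 h2 h3 h4
          rw [RingHom.id_apply, h1, h4, Pi.smul_apply, h2]
          by_cases hx : x ∈ Λ
          · rw [Set.indicator_of_mem hx, Set.indicator_of_mem hx, h3, Pi.smul_apply]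
          · simp [hx] } 1 (by
          intro f
          rw [one_mul]
          apply Lp.norm_le_norm_of_ae_le
          filter_upwards [indicatorL2_coeFn hΛ f] with x h1
          change ‖indicatorL2 hΛ f x‖ ≤ _
          rw [h1]
          exact norm_indicator_le_norm_self _ _)
  else 0

theorem restrictOp_coeFn {Λ : Set (EuclideanSpace ℝ (Fin d))} (hΛ : MeasurableSet Λ) (f : L2 d) :
    restrictOp Λ f =ᵐ[volume] Λ.indicator f := by
  rw [restrictOp, dif_pos hΛ]
  exact indicatorL2_coeFn hΛ f

theorem star_restrictOp {Λ : Set (EuclideanSpace ℝ (Fin d))} (hΛ : MeasurableSet Λ) :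
    star (restrictOp Λ) = restrictOp Λ := by
  rw [ContinuousLinearMap.star_eq_adjoint, eq_comm, ContinuousLinearMap.eq_adjoint_iff]
  intro f g
  rw [L2.inner_def, L2.inner_def]
  apply integral_congr_ae
  filter_upwards [restrictOp_coeFn hΛ f, restrictOp_coeFn hΛ g] with x h1 h2
  rw [h1, h2]
  by_cases hx : x ∈ Λ <;> simp [hx]

/-- `M_Λ = P_Λ 𝒦 P_Λ`. -/
def locM (𝒦 : L2 d →L[ℂ] L2 d) (Λ : Set (EuclideanSpace ℝ (Fin d))) : L2 d →L[ℂ] L2 d :=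
  restrictOp Λ ∘L 𝒦 ∘L restrictOp Λ

/-- `N_Λ = 𝒦 P_Λ`. -/
def locN (𝒦 : L2 d →L[ℂ] L2 d) (Λ : Set (EuclideanSpace ℝ (Fin d))) : L2 d →L[ℂ] L2 d :=
  𝒦 ∘L restrictOp Λ

/-- For an orthogonal projection `𝒦`, `N_Λ* N_Λ = M_Λ`. -/
theorem star_locN_mul_locN {𝒦 : L2 d →L[ℂ] L2 d} (h𝒦 : IsStarProjection 𝒦)
    {Λ : Set (EuclideanSpace ℝ (Fin d))} (hΛ : MeasurableSet Λ) :
    star (locN 𝒦 Λ) * locN 𝒦 Λ = locM 𝒦 Λ := by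
  have h : locN 𝒦 Λ = 𝒦 * restrictOp Λ := rfl
  have h' : locM 𝒦 Λ = restrictOp Λ * (𝒦 * restrictOp Λ) := rfl
  have hi : 𝒦 * 𝒦 = 𝒦 := h𝒦.isIdempotentElem
  have hs : star 𝒦 = 𝒦 := h𝒦.isSelfAdjoint
  rw [h, h', star_mul, star_restrictOp hΛ, hs, mul_assoc, ← mul_assoc 𝒦 𝒦, hi]

/-- `|N_Λ| = √M_Λ`. -/
theorem abs_locN {𝒦 : L2 d →L[ℂ] L2 d} (h𝒦 : IsStarProjection 𝒦)
    {Λ : Set (EuclideanSpace ℝ (Fin d))} (hΛ : MeasurableSet Λ) :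
    opAbs (locN 𝒦 Λ) = opSqrt (locM 𝒦 Λ) := by
  rw [opAbs, star_locN_mul_locN h𝒦 hΛ]

/-- `𝒦` is locally trace class: `P_Λ 𝒦 P_Λ` is trace class for all bounded Borel sets `Λ`. -/
def IsLocallyTraceClass (𝒦 : L2 d →L[ℂ] L2 d) : Prop :=
  ∀ Λ : Set (EuclideanSpace ℝ (Fin d)), MeasurableSet Λ → Bornology.IsBounded Λ →
    IsTraceClass (locM 𝒦 Λ)

/-- `K` is the kernel of the orthogonal projection `𝒦`: it is (a.e. equal to) a measurable
function, almost all of its sections are square integrable, `𝒦 f(x) = ∫ K(x,y) f(y) dy` for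
almost all `x`, and its values on the diagonal, which is a null set, are the ones given by the
reproducing property `∫ K(x,y) K(y,z) dy = K(x,z)`. -/
structure IsProjectionKernel (𝒦 : L2 d →L[ℂ] L2 d)
    (K : EuclideanSpace ℝ (Fin d) → EuclideanSpace ℝ (Fin d) → ℂ) : Prop where
  aestronglyMeasurable :
    AEStronglyMeasurable (fun p : EuclideanSpace ℝ (Fin d) × EuclideanSpace ℝ (Fin d) =>
      K p.1 p.2) (volume.prod volume)
  memLp_section : ∀ᵐ x, MemLp (fun y => K x y) 2 volume
  apply_ae_eq : ∀ f : L2 d, ∀ᵐ x, 𝒦 f x = ∫ y, K x y * f y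
  reproducing_diag : ∀ᵐ x, ∫ y, K x y * K y x = K x x

/-- `|K(x,y)|² = φ(‖x - y‖)` for almost all `x, y`, for some `φ : [0,∞) → [0,∞)`. -/
def IsRadialKernel (K : EuclideanSpace ℝ (Fin d) → EuclideanSpace ℝ (Fin d) → ℂ) : Prop :=
  ∃ φ : ℝ≥0 → ℝ≥0,
    ∀ᵐ p : EuclideanSpace ℝ (Fin d) × EuclideanSpace ℝ (Fin d) ∂(volume.prod volume),
      ‖K p.1 p.2‖ ^ 2 = (φ (nndist p.1 p.2) : ℝ)

/-- `N_Λ`, the upper integer part of `Tr M_Λ` (which is real and non-negative). -/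
def numEigen (𝒦 : L2 d →L[ℂ] L2 d) (Λ : Set (EuclideanSpace ℝ (Fin d))) : ℕ :=
  ⌈(opTrace (locM 𝒦 Λ)).re⌉₊

/-- The accumulated spectrogram `ρ_Λ = ∑_{j ≤ N_Λ} |Ψ_j|²`, `Ψ_j = W_Λ Φ_j`, for eigenfunctions
`Φ_0, Φ_1, ...` of `M_Λ` (numbered from `0`), where `N_Λ = W_Λ √M_Λ` is the polar
decomposition. -/
def accumulatedSpectrogram (𝒦 : L2 d →L[ℂ] L2 d) (Λ : Set (EuclideanSpace ℝ (Fin d)))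
    (Φ : ℕ → L2 d) (x : EuclideanSpace ℝ (Fin d)) : ℝ :=
  ∑ j ∈ Finset.range (numEigen 𝒦 Λ), ‖polarFactor (locN 𝒦 Λ) (Φ j) x‖ ^ 2

end Localization

end

/-! Write `A = R • Λ`, `n = N_A` and `Ψ_j = W_A Φ_j`. The proof bounds the `L¹` distance from `ρ_A`
to `1_A` by `1 + 2I(A)`, where `I(A) = ∫_A ∫_{Aᶜ} |K|²`, and shows that `I(R • Λ) = o(R^d)`.

Each `Ψ_j` equals `μ_j^{-1/2} 𝒦 P_A Φ_j` (or `0` if `μ_j = 0`). It lies in the range of `𝒦`, has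
norm at most `1`, and has mass exactly `μ_j` on `A`. The kernel is Hermitian, so `K(x,x) = 1` and
the reproducing property make almost every row of `K` a unit vector. Evaluation at `x` on the range
of `𝒦` is the inner product with such a vector, and Bessel's inequality gives `0 ≤ ρ_A ≤ 1`
(`IsProjectionKernel.ae_sum_norm_sq_le_one`).

Hence `|ρ_A - 1_A|` is `1 - ρ_A` on `A` and `ρ_A` off `A`, with total integral at most `(|A| - S) +
(n - S)`, where `S` is the sum of the first `n` eigenvalues. Since `∑ μ_j = Tr M_A = |A|` and `n ≤
|A| + 1`, this is at most `1` plus twice the tail of the eigenvalues. Monotonicity bounds the tail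
by `∑ μ_j (1 - μ_j)` (`tsum_tail_le_tsum_mul_one_sub`), which is the squared Hilbert-Schmidt norm of
`P_{Aᶜ} 𝒦 P_A`, that is `I(A)` (`IsProjectionKernel.tsum_eigenvalues_mul_one_sub`).

Radiality gives `|K(x,y)|² = g(x - y)` with `∫ g = 1`. After rescaling, `R^{-d} I(R • Λ)` is the
integral of `g(z)` over `v ∈ Λ` and `v - z/R ∉ Λ`; it tends to `0` by dominated convergence because
`Λ` is open (`tendsto_lintegral_interaction`). -/

theorem HasSum.congr_terms {ι α : Type*} [AddCommMonoid α] [TopologicalSpace α] {f g : ι → α}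
    {a : α} (h : HasSum f a) (e : ∀ i, g i = f i) : HasSum g a :=
  (funext e : g = f) ▸ h

/-! ### Spectral sums and the polar factor on eigenvectors -/

section SpectralSums

universe u

variable {H : Type u} [NormedAddCommGroup H] [InnerProductSpace ℂ H]

/-- Parseval's identity, with values in `ℝ≥0∞`. -/
theorem HilbertBasis.tsum_enorm_inner_sq {ι : Type*} (b : HilbertBasis ι ℂ H) (v : H) :
    ∑' i, ‖⟪v, b i⟫_ℂ‖ₑ ^ 2 = ‖v‖ₑ ^ 2 := by
  have h := (b.hasSum_inner_mul_inner v v).mapL (RCLike.reCLM (K := ℂ))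
  have h2 : HasSum (fun i => ‖⟪v, b i⟫_ℂ‖ ^ 2) (‖v‖ ^ 2) := by
    have e : RCLike.reCLM (K := ℂ) ⟪v, v⟫_ℂ = ‖v‖ ^ 2 := by
      rw [inner_self_eq_norm_sq_to_K]
      simp [← Complex.ofReal_pow]
    rw [← e]
    refine HasSum.congr_terms h fun i => ?_
    rw [← inner_conj_symm (b i) v, RCLike.mul_conj]
    simp [← Complex.ofReal_pow]
  have h3 := ENNReal.ofReal_tsum_of_nonneg (fun i => by positivity) h2.summable
  rw [h2.tsum_eq] at h3
  simpa [ENNReal.ofReal_pow, ofReal_norm] using h3.symm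

theorem IsSpectralDecomposition.inner_apply {T : H →L[ℂ] H} {μ : ℕ → ℝ} {Φ : ℕ → H}
    (h : IsSpectralDecomposition T μ Φ) (j : ℕ) (f : H) :
    ⟪Φ j, T f⟫_ℂ = μ j * ⟪Φ j, f⟫_ℂ := by
  have h1 := (h.hasSum f).mapL (innerSL ℂ (Φ j))
  refine h1.unique ?_
  refine HasSum.congr_terms (hasSum_ite_eq j ((μ j : ℂ) * ⟪Φ j, f⟫_ℂ)) fun k => ?_
  rw [innerSL_apply_apply, inner_smul_right, orthonormal_iff_ite.1 h.orthonormal j k]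
  by_cases hk : k = j
  · subst hk; simp
  · simp [hk, Ne.symm hk]

theorem IsSpectralDecomposition.apply_eigenvector {T : H →L[ℂ] H} {μ : ℕ → ℝ} {Φ : ℕ → H}
    (h : IsSpectralDecomposition T μ Φ) (j : ℕ) : T (Φ j) = (μ j : ℂ) • Φ j := by
  refine (h.hasSum (Φ j)).unique ?_
  refine HasSum.congr_terms (hasSum_ite_eq j ((μ j : ℂ) • Φ j)) fun k => ?_
  rw [orthonormal_iff_ite.1 h.orthonormal k j]
  by_cases hk : k = j
  · subst hk; simp
  · simp [hk]

theorem IsSpectralDecomposition.hasSum_inner {T : H →L[ℂ] H} {μ : ℕ → ℝ} {Φ : ℕ → H}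
    (h : IsSpectralDecomposition T μ Φ) (f : H) :
    HasSum (fun j => μ j * ‖⟪Φ j, f⟫_ℂ‖ ^ 2) (RCLike.re ⟪f, T f⟫_ℂ) := by
  have h1 := ((h.hasSum f).mapL (innerSL ℂ f)).mapL (RCLike.reCLM (K := ℂ))
  refine HasSum.congr_terms h1 fun j => ?_
  rw [innerSL_apply_apply, inner_smul_right, mul_assoc, ← inner_conj_symm f (Φ j),
    RCLike.mul_conj]
  simp [← Complex.ofReal_pow]

theorem IsSpectralDecomposition.hasSum_norm_sq {T : H →L[ℂ] H} {μ : ℕ → ℝ} {Φ : ℕ → H}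
    (h : IsSpectralDecomposition T μ Φ) (f : H) :
    HasSum (fun j => μ j ^ 2 * ‖⟪Φ j, f⟫_ℂ‖ ^ 2) (‖T f‖ ^ 2) := by
  have h1 := ((h.hasSum f).mapL (innerSL ℂ (T f))).mapL (RCLike.reCLM (K := ℂ))
  have e : RCLike.reCLM (K := ℂ) (innerSL ℂ (T f) (T f)) = ‖T f‖ ^ 2 := by
    rw [innerSL_apply_apply, inner_self_eq_norm_sq_to_K]
    simp [← Complex.ofReal_pow]
  rw [← e]
  refine HasSum.congr_terms h1 fun j => ?_
  rw [innerSL_apply_apply, inner_smul_right, ← inner_conj_symm (T f) (Φ j), h.inner_apply,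
    RCLike.mul_conj]
  simp [← Complex.ofReal_pow, mul_pow, abs_of_nonneg (h.nonneg j)]

/-- If a quadratic form is diagonal in an orthonormal family, with weights `w`, then its diagonal
sum in an orthonormal basis is the sum of the weights. -/
theorem tsum_quadraticForm_eq_tsum_weights {ι : Type*} (b : HilbertBasis ι ℂ H) {Φ : ℕ → H}
    (hΦ : Orthonormal ℂ Φ) {w : ℕ → ℝ} (hw : ∀ j, 0 ≤ w j) {q : H → ℝ}
    (hq : ∀ f, HasSum (fun j => w j * ‖⟪Φ j, f⟫_ℂ‖ ^ 2) (q f)) :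
    ∑' i, ENNReal.ofReal (q (b i)) = ∑' j, ENNReal.ofReal (w j) := by
  have h1 : ∀ i, ENNReal.ofReal (q (b i))
      = ∑' j, ENNReal.ofReal (w j) * ‖⟪Φ j, b i⟫_ℂ‖ₑ ^ 2 := by
    intro i
    rw [← (hq (b i)).tsum_eq, ENNReal.ofReal_tsum_of_nonneg
      (fun j => mul_nonneg (hw j) (by positivity)) (hq (b i)).summable]
    congr 1
    ext j
    rw [ENNReal.ofReal_mul (hw j), ENNReal.ofReal_pow (norm_nonneg _), ofReal_norm]
  simp_rw [h1]
  rw [ENNReal.tsum_comm]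
  congr 1
  ext j
  rw [ENNReal.tsum_mul_left, b.tsum_enorm_inner_sq]
  simp [← ofReal_norm, hΦ.norm_eq_one]

variable [CompleteSpace H]

theorem inner_star_mul_self_apply (N : H →L[ℂ] H) (f : H) :
    ⟪f, (star N * N) f⟫_ℂ = ((‖N f‖ ^ 2 : ℝ) : ℂ) := by
  rw [ContinuousLinearMap.star_eq_adjoint, mul_apply_eq_comp,
    ContinuousLinearMap.adjoint_inner_right, inner_self_eq_norm_sq_to_K]
  simp

/-- With `S = |N|` and `S² v = t v`, the defect `u = S v - √t v` satisfies `S u = -√t u`. Positivity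
of `S` then forces `u = 0`, without any functional calculus. -/
theorem opAbs_apply_eigenvector (N : H →L[ℂ] H) {t : ℝ} (ht : 0 < t) {v : H}
    (hv : (star N * N) v = (t : ℂ) • v) : opAbs N v = ((√t : ℝ) : ℂ) • v := by
  set S := opAbs N with hS
  have hSS : S * S = star N * N := by rw [hS, opAbs_eq, CFC.abs_mul_abs]
  set u : H := S v - ((√t : ℝ) : ℂ) • v with hu
  have hSu : S u = -(((√t : ℝ) : ℂ) • u) := by
    have h1 : S (S v) = (t : ℂ) • v := by rw [← hv, ← hSS]; rfl
    have h2 : (t : ℂ) = ((√t : ℝ) : ℂ) * ((√t : ℝ) : ℂ) := by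
      rw [← Complex.ofReal_mul, Real.mul_self_sqrt ht.le]
    rw [hu, map_sub, map_smul, h1, h2, smul_sub, smul_smul]
    abel
  have hpos : S.IsPositive := by
    rw [← ContinuousLinearMap.nonneg_iff_isPositive]
    exact CFC.abs_nonneg N
  have h3 := hpos.re_inner_nonneg_right u
  rw [hSu, inner_neg_right, inner_smul_right, inner_self_eq_norm_sq_to_K] at h3
  have h4 : 0 ≤ -(√t * ‖u‖ ^ 2) := by
    simpa [← Complex.ofReal_pow] using h3
  have h5 : ‖u‖ ^ 2 ≤ 0 := by
    have := Real.sqrt_pos.2 ht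
    by_contra hc
    push Not at hc
    nlinarith [mul_pos this hc]
  have h6 : u = 0 := by
    have := pow_eq_zero_iff (two_ne_zero) |>.1 (le_antisymm h5 (by positivity))
    simpa using this
  exact sub_eq_zero.1 h6

theorem polarFactor_apply_eigenvector (N : H →L[ℂ] H) {t : ℝ} (ht : 0 < t) {v : H}
    (hv : (star N * N) v = (t : ℂ) • v) :
    polarFactor N v = (((√t)⁻¹ : ℝ) : ℂ) • N v := by
  have h := polarFactor_abs_apply N v
  rw [opAbs_apply_eigenvector N ht hv, map_smul] at h
  have h0 : ((√t : ℝ) : ℂ) ≠ 0 := by exact_mod_cast (Real.sqrt_pos.2 ht).ne'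
  rw [← h, smul_smul, Complex.ofReal_inv, inv_mul_cancel₀ h0, one_smul]

/-- The map `|N| f ↦ N f` preserves norms, so its extension is a contraction, and it is precomposed
with an orthogonal projection. -/
theorem norm_polarFactor_le (N : H →L[ℂ] H) : ‖polarFactor N‖ ≤ 1 := by
  have h1 : ‖LinearMap.extendOfNorm N.toLinearMap (absCodRestrict N).toLinearMap‖ ≤ 1 :=
    LinearMap.opNorm_extendOfNorm_le (absCodRestrict_denseRange N) zero_le_one fun x => by
      have : ‖absCodRestrict N x‖ = ‖opAbs N x‖ := rfl
      simp [this, norm_abs_apply]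
  calc ‖polarFactor N‖ ≤ _ := ContinuousLinearMap.opNorm_comp_le _ _
    _ ≤ 1 * 1 := mul_le_mul h1 (Submodule.orthogonalProjectionOnto_norm_le _)
        (norm_nonneg _) zero_le_one
    _ = 1 := one_mul 1

/-- Bessel's inequality for the image of an orthonormal family under a contraction. -/
theorem sum_norm_inner_contraction_sq_le {ι : Type*} {Φ : ι → H} (hΦ : Orthonormal ℂ Φ)
    {W : H →L[ℂ] H} (hW : ‖W‖ ≤ 1) (s : Finset ι) (v : H) :
    ∑ j ∈ s, ‖⟪v, W (Φ j)⟫_ℂ‖ ^ 2 ≤ ‖v‖ ^ 2 := by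
  have h1 : ∀ j, ‖⟪v, W (Φ j)⟫_ℂ‖ = ‖⟪Φ j, ContinuousLinearMap.adjoint W v⟫_ℂ‖ := by
    intro j
    rw [ContinuousLinearMap.adjoint_inner_right, norm_inner_symm]
  simp_rw [h1]
  refine (hΦ.sum_inner_products_le _).trans ?_
  gcongr
  refine (ContinuousLinearMap.le_opNorm _ _).trans ?_
  rw [LinearIsometryEquiv.norm_map]
  exact mul_le_of_le_one_left (norm_nonneg _) hW

end SpectralSums

/-- For a non-increasing sequence in `[0, 1]` with sum at most `n`, the tail from `n` on is
at most `∑ μ_j (1 - μ_j)`. -/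
theorem tsum_tail_le_tsum_mul_one_sub {μ : ℕ → ℝ} (hanti : Antitone μ) (h0 : ∀ j, 0 ≤ μ j)
    (h1 : ∀ j, μ j ≤ 1) (hs : Summable μ) {n : ℕ} (hn : ∑' j, μ j ≤ n) :
    ∑' j, μ (j + n) ≤ ∑' j, μ j * (1 - μ j) := by
  have hs2 : Summable fun j => μ j * (1 - μ j) :=
    Summable.of_nonneg_of_le (fun j => mul_nonneg (h0 j) (by linarith [h1 j]))
      (fun j => mul_le_of_le_one_right (h0 j) (by linarith [h0 j])) hs
  have e1 := hs.sum_add_tsum_nat_add n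
  have e2 := hs2.sum_add_tsum_nat_add n
  have hst := (summable_nat_add_iff n).2 hs
  have hst2 := (summable_nat_add_iff n).2 hs2
  set t := ∑' j, μ (j + n) with ht
  have ht0 : 0 ≤ t := tsum_nonneg fun j => h0 _
  -- The value `μ n` separates the two ranges: from `n` on, `1 - μ j ≥ 1 - μ n`; before `n`, `μ j ≥
  -- μ n`. As the total is at most `n`, the tail `t` is at most the deficit `∑_{j<n} (1 - μ j)`, so
  -- the two ranges contribute at least `(1 - μ n) t + μ n t = t`.
  have a1 : (1 - μ n) * t ≤ ∑' j, μ (j + n) * (1 - μ (j + n)) := by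
    rw [ht, ← tsum_mul_left]
    refine Summable.tsum_le_tsum (fun j => ?_) (hst.mul_left _) hst2
    have := hanti (Nat.le_add_left n j)
    nlinarith [h0 (j + n)]
  have a2 : μ n * ∑ j ∈ Finset.range n, (1 - μ j) ≤ ∑ j ∈ Finset.range n, μ j * (1 - μ j) := by
    rw [Finset.mul_sum]
    refine Finset.sum_le_sum fun j hj => ?_
    have := hanti (Finset.mem_range.1 hj).le
    exact mul_le_mul_of_nonneg_right this (by linarith [h1 j])
  have a3 : ∑ j ∈ Finset.range n, (1 - μ j) = n - ∑ j ∈ Finset.range n, μ j := by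
    simp [Finset.sum_sub_distrib]
  have a4 : μ n * t ≤ μ n * ∑ j ∈ Finset.range n, (1 - μ j) :=
    mul_le_mul_of_nonneg_left (by linarith) (h0 n)
  linarith

/-- An integrable function on a product whose integrals over all measurable rectangles vanish is
zero almost everywhere. -/
theorem ae_eq_zero_of_forall_setIntegral_prod_eq_zero {X Y : Type*} [MeasurableSpace X]
    [MeasurableSpace Y] {μ : Measure X} {ν : Measure Y} [SFinite μ] [SFinite ν] {h : X × Y → ℂ}
    (hint : Integrable h (μ.prod ν))
    (hrect : ∀ A B, MeasurableSet A → MeasurableSet B → ∫ p in A ×ˢ B, h p ∂μ.prod ν = 0) :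
    h =ᵐ[μ.prod ν] 0 := by
  have huniv : ∫ p, h p ∂μ.prod ν = 0 := by
    simpa using hrect Set.univ Set.univ .univ .univ
  have main : ∀ s, MeasurableSet s → ∫ p in s, h p ∂μ.prod ν = 0 := by
    intro s hs
    induction s, hs using MeasurableSpace.induction_on_inter generateFrom_prod.symm
      isPiSystem_prod with
    | empty => simp
    | basic t ht =>
      obtain ⟨A, hA, B, hB, rfl⟩ := ht
      exact hrect A B hA hB
    | compl t htm ih =>
      have := integral_add_compl htm hint
      rwa [ih, zero_add, huniv] at this
    | iUnion f hd hm ih =>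
      rw [integral_iUnion hm hd hint.integrableOn]
      simp [ih]
  exact hint.ae_eq_zero_of_forall_setIntegral_eq_zero fun s hs _ => main s hs

/-! ### The kernel: radial profile, Hermitian symmetry, unit rows -/

section Kernel

variable {d : ℕ} {𝒦 : L2 d →L[ℂ] L2 d}
  {K : EuclideanSpace ℝ (Fin d) → EuclideanSpace ℝ (Fin d) → ℂ}

/-- The function `φ` is not assumed measurable. A single good row `K x ·` is square integrable and
equals `g₀ (x - ·)` in squared modulus, which makes `g₀` a.e. measurable and integrable. Passing to
a measurable version may destroy exact evenness, hence both orders of subtraction in the conclusion.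
-/
theorem IsRadialKernel.exists_measurable_profile (hrad : IsRadialKernel K)
    (hK : IsProjectionKernel 𝒦 K) :
    ∃ g : EuclideanSpace ℝ (Fin d) → ℝ≥0∞, Measurable g ∧ ∫⁻ z, g z ≠ ∞ ∧
      (∀ᵐ p : EuclideanSpace ℝ (Fin d) × EuclideanSpace ℝ (Fin d) ∂volume.prod volume,
        ‖K p.1 p.2‖ₑ ^ 2 = g (p.1 - p.2)) ∧
      (∀ᵐ p : EuclideanSpace ℝ (Fin d) × EuclideanSpace ℝ (Fin d) ∂volume.prod volume,
        ‖K p.1 p.2‖ₑ ^ 2 = g (p.2 - p.1)) := by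
  obtain ⟨φ, hφ⟩ := hrad
  set g₀ : EuclideanSpace ℝ (Fin d) → ℝ≥0∞ := fun z => φ ‖z‖₊ with hg₀
  have hφ' : ∀ᵐ p : EuclideanSpace ℝ (Fin d) × EuclideanSpace ℝ (Fin d) ∂volume.prod volume,
      ‖K p.1 p.2‖ₑ ^ 2 = g₀ (p.1 - p.2) := by
    filter_upwards [hφ] with p hp
    rw [nndist_eq_nnnorm] at hp
    have : ‖K p.1 p.2‖₊ ^ 2 = φ ‖p.1 - p.2‖₊ := NNReal.eq (by simpa using hp)
    simp only [hg₀, enorm_eq_nnnorm]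
    exact_mod_cast this
  obtain ⟨x, hx, hx2⟩ := ((Measure.ae_ae_of_ae_prod hφ').and hK.memLp_section).exists
  have hxm : AEMeasurable (fun y => g₀ (x - y)) volume :=
    (hx2.aestronglyMeasurable.enorm.pow_const 2).congr hx
  have hfin : ∫⁻ y, g₀ (x - y) ≠ ∞ := by
    rw [← lintegral_congr_ae hx]
    have := (memLp_two_iff_integrable_sq_norm hx2.1).1 hx2
    have h2 := this.hasFiniteIntegral
    rw [hasFiniteIntegral_iff_enorm] at h2
    refine ne_of_lt (lt_of_eq_of_lt (lintegral_congr fun y => ?_) h2)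
    simp [enorm_pow]
  have hmp : MeasurePreserving (fun y : EuclideanSpace ℝ (Fin d) => x - y) volume volume :=
    Measure.measurePreserving_sub_left volume x
  have hgm : AEMeasurable g₀ volume := by
    have := hxm.comp_quasiMeasurePreserving hmp.quasiMeasurePreserving
    refine this.congr (ae_of_all _ fun y => ?_)
    simp
  have hq := quasiMeasurePreserving_sub (volume : Measure (EuclideanSpace ℝ (Fin d)))
    (volume : Measure (EuclideanSpace ℝ (Fin d)))
  have hq' := hq.comp (Measure.measurePreserving_swap
    (μ := (volume : Measure (EuclideanSpace ℝ (Fin d)))) (ν := volume)).quasiMeasurePreserving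
  refine ⟨hgm.mk g₀, hgm.measurable_mk, ?_, ?_, ?_⟩
  · rw [← lintegral_congr_ae hgm.ae_eq_mk, ← lintegral_sub_left_eq_self g₀ x]
    exact hfin
  · filter_upwards [hφ', hq.ae hgm.ae_eq_mk] with p h1 h2
    rw [h1, h2]
  · filter_upwards [hφ', hq'.ae hgm.ae_eq_mk] with p h1 h2
    have h3 : g₀ (p.1 - p.2) = g₀ (p.2 - p.1) := by
      rw [hg₀]; simp only []; rw [← nnnorm_neg, neg_sub]
    rw [h1, h3]
    exact h2

theorem ae_lintegral_profile_eq {g : EuclideanSpace ℝ (Fin d) → ℝ≥0∞}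
    (hg : ∀ᵐ p : EuclideanSpace ℝ (Fin d) × EuclideanSpace ℝ (Fin d) ∂volume.prod volume,
        ‖K p.1 p.2‖ₑ ^ 2 = g (p.1 - p.2)) :
    ∀ᵐ x, ∫⁻ y, ‖K x y‖ₑ ^ 2 = ∫⁻ z, g z := by
  filter_upwards [Measure.ae_ae_of_ae_prod hg] with x hx
  rw [lintegral_congr_ae hx, lintegral_sub_left_eq_self]

/-- On a set of finite measure `|K| ≤ 1 + |K|²` suffices, since almost all rows have the same finite
squared norm `∫ g`. This justifies Fubini on rectangles. -/
theorem IsProjectionKernel.integrable_prod_restrict (hK : IsProjectionKernel 𝒦 K)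
    (hrad : IsRadialKernel K) {A B : Set (EuclideanSpace ℝ (Fin d))}
    (hA : volume A ≠ ∞) (hB : volume B ≠ ∞) :
    Integrable (fun p : EuclideanSpace ℝ (Fin d) × EuclideanSpace ℝ (Fin d) => K p.1 p.2)
      ((volume.restrict A).prod (volume.restrict B)) := by
  obtain ⟨g, hgm, hgi, hg, -⟩ := hrad.exists_measurable_profile hK
  have hle : (volume.restrict A).prod (volume.restrict B) ≤
      (volume.prod volume : Measure (EuclideanSpace ℝ (Fin d) × EuclideanSpace ℝ (Fin d))) := by
    rw [Measure.prod_restrict]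
    exact Measure.restrict_le_self
  have hmeas := hK.aestronglyMeasurable.mono_measure hle
  refine ⟨hmeas, ?_⟩
  rw [hasFiniteIntegral_iff_enorm]
  have : IsFiniteMeasure ((volume : Measure (EuclideanSpace ℝ (Fin d))).restrict A) :=
    ⟨by simpa using hA.lt_top⟩
  have : IsFiniteMeasure ((volume : Measure (EuclideanSpace ℝ (Fin d))).restrict B) :=
    ⟨by simpa using hB.lt_top⟩
  calc _ ≤ ∫⁻ p, (1 + ‖K p.1 p.2‖ₑ ^ 2) ∂(volume.restrict A).prod (volume.restrict B) := by
        refine lintegral_mono fun p => ?_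
        rcases le_total ‖K p.1 p.2‖ₑ 1 with h | h
        · exact h.trans le_self_add
        · exact (le_self_pow₀ h two_ne_zero).trans le_add_self
    _ = ((volume.restrict A).prod (volume.restrict B)) Set.univ
        + ∫⁻ x in A, ∫⁻ y in B, ‖K x y‖ₑ ^ 2 := by
        rw [lintegral_add_left measurable_const, lintegral_prod _ (hmeas.enorm.pow_const 2)]
        simp
    _ ≤ ((volume.restrict A).prod (volume.restrict B)) Set.univ + ∫⁻ x in A, ∫⁻ z, g z := by
        refine add_le_add le_rfl ?_
        refine lintegral_mono_ae ?_
        filter_upwards [ae_restrict_of_ae (ae_lintegral_profile_eq hg)] with x hx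
        rw [← hx]
        exact setLIntegral_le_lintegral _ _
    _ < ∞ := by
        refine ENNReal.add_lt_top.2 ⟨measure_lt_top _ _, ?_⟩
        rw [lintegral_const]
        exact ENNReal.mul_lt_top hgi.lt_top (by simpa using hA.lt_top)

/-- Rectangle integrals of `K` are matrix entries of `𝒦`; this is how self-adjointness passes from
the operator to the kernel. -/
theorem IsProjectionKernel.setIntegral_prod_eq_inner (hK : IsProjectionKernel 𝒦 K)
    (hrad : IsRadialKernel K) {A B : Set (EuclideanSpace ℝ (Fin d))}
    (hAm : MeasurableSet A) (hBm : MeasurableSet B) (hA : volume A ≠ ∞) (hB : volume B ≠ ∞) :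
    ∫ p, K p.1 p.2 ∂(volume.restrict A).prod (volume.restrict B)
      = ⟪(indicatorConstLp 2 hAm hA (1 : ℂ) : L2 d), 𝒦 (indicatorConstLp 2 hBm hB (1 : ℂ))⟫_ℂ := by
  rw [integral_prod _ (hK.integrable_prod_restrict hrad hA hB), L2.inner_indicatorConstLp_one]
  refine integral_congr_ae (ae_restrict_of_ae ?_)
  filter_upwards [hK.apply_ae_eq (indicatorConstLp 2 hBm hB (1 : ℂ))] with x hx
  rw [hx, ← integral_indicator hBm]
  refine integral_congr_ae ?_
  filter_upwards [indicatorConstLp_coeFn (p := 2) (hs := hBm) (hμs := hB) (c := (1 : ℂ))] with y hy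
  rw [hy]
  by_cases hyB : y ∈ B <;> simp [hyB]

/-- The kernel of an orthogonal projection is Hermitian. -/
theorem IsProjectionKernel.ae_eq_conj (hK : IsProjectionKernel 𝒦 K) (h𝒦 : IsStarProjection 𝒦)
    (hrad : IsRadialKernel K) :
    ∀ᵐ p : EuclideanSpace ℝ (Fin d) × EuclideanSpace ℝ (Fin d) ∂volume.prod volume,
      K p.2 p.1 = starRingEnd ℂ (K p.1 p.2) := by
  -- `K` need not be integrable on the whole product, so the rectangle test is applied on products
  -- of balls, which exhaust the space.
  have key : ∀ n : ℕ, ∀ᵐ p : EuclideanSpace ℝ (Fin d) × EuclideanSpace ℝ (Fin d)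
      ∂(volume.restrict (Metric.ball 0 n)).prod (volume.restrict (Metric.ball 0 n)),
      K p.2 p.1 - starRingEnd ℂ (K p.1 p.2) = 0 := by
    intro n
    have hV : volume (Metric.ball (0 : EuclideanSpace ℝ (Fin d)) n) ≠ ∞ := measure_ball_lt_top.ne
    have hi := hK.integrable_prod_restrict hrad hV hV
    have hi1 := hi.swap
    have hi2 : Integrable (fun p : EuclideanSpace ℝ (Fin d) × EuclideanSpace ℝ (Fin d) =>
        starRingEnd ℂ (K p.1 p.2)) ((volume.restrict (Metric.ball 0 n)).prod
          (volume.restrict (Metric.ball 0 n))) :=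
      hi.mono (Complex.continuous_conj.comp_aestronglyMeasurable hi.1)
        (ae_of_all _ fun p => by simp)
    refine ae_eq_zero_of_forall_setIntegral_prod_eq_zero (hi1.sub hi2) fun A B hA hB => ?_
    have hAV : volume (A ∩ Metric.ball (0 : EuclideanSpace ℝ (Fin d)) n) ≠ ∞ :=
      measure_ne_top_of_subset Set.inter_subset_right hV
    have hBV : volume (B ∩ Metric.ball (0 : EuclideanSpace ℝ (Fin d)) n) ≠ ∞ :=
      measure_ne_top_of_subset Set.inter_subset_right hV
    have hAm := hA.inter (Metric.isOpen_ball (x := (0 : EuclideanSpace ℝ (Fin d)))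
      (ε := n)).measurableSet
    have hBm := hB.inter (Metric.isOpen_ball (x := (0 : EuclideanSpace ℝ (Fin d)))
      (ε := n)).measurableSet
    rw [← Measure.prod_restrict, Measure.restrict_restrict hA, Measure.restrict_restrict hB]
    have e1 := hK.setIntegral_prod_eq_inner hrad hAm hBm hAV hBV
    have e2 := hK.setIntegral_prod_eq_inner hrad hBm hAm hBV hAV
    have i1 := hK.integrable_prod_restrict hrad hAV hBV
    have i2 := (hK.integrable_prod_restrict hrad hBV hAV).swap
    have i1' : Integrable (fun p : EuclideanSpace ℝ (Fin d) × EuclideanSpace ℝ (Fin d) =>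
        starRingEnd ℂ (K p.1 p.2)) ((volume.restrict (A ∩ Metric.ball 0 n)).prod
          (volume.restrict (B ∩ Metric.ball 0 n))) :=
      i1.mono (Complex.continuous_conj.comp_aestronglyMeasurable i1.1)
        (ae_of_all _ fun p => by simp)
    have e3 := integral_prod_swap (μ := volume.restrict (B ∩ Metric.ball 0 n))
      (ν := volume.restrict (A ∩ Metric.ball 0 n))
      (fun p : EuclideanSpace ℝ (Fin d) × EuclideanSpace ℝ (Fin d) => K p.1 p.2)
    simp only [Prod.fst_swap, Prod.snd_swap] at e3
    calc _ = ∫ p, K p.2 p.1 ∂((volume.restrict (A ∩ Metric.ball 0 n)).prod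
          (volume.restrict (B ∩ Metric.ball 0 n)))
        - ∫ p, starRingEnd ℂ (K p.1 p.2) ∂((volume.restrict (A ∩ Metric.ball 0 n)).prod
          (volume.restrict (B ∩ Metric.ball 0 n))) := integral_sub i2 i1'
      _ = 0 := by
        rw [integral_conj, e1, e3, e2, inner_conj_symm, sub_eq_zero]
        nth_rewrite 2 [← h𝒦.isSelfAdjoint.star_eq]
        rw [ContinuousLinearMap.star_eq_adjoint, ContinuousLinearMap.adjoint_inner_left]
  have hU : (⋃ n : ℕ, Metric.ball (0 : EuclideanSpace ℝ (Fin d)) n ×ˢ Metric.ball 0 n)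
      = (Set.univ : Set (EuclideanSpace ℝ (Fin d) × EuclideanSpace ℝ (Fin d))) := by
    refine Set.eq_univ_of_forall fun p => ?_
    obtain ⟨n, hn⟩ := exists_nat_gt (max ‖p.1‖ ‖p.2‖)
    refine Set.mem_iUnion.2 ⟨n, ?_⟩
    simpa using hn
  rw [← Measure.restrict_univ (μ := volume.prod volume), ← hU, ae_restrict_iUnion_iff]
  intro n
  rw [← Measure.prod_restrict]
  filter_upwards [key n] with p hp
  exact sub_eq_zero.1 hp

/-- The rows of a Hermitian normalized projection kernel are unit vectors. -/
theorem IsProjectionKernel.lintegral_profile_eq_one (hK : IsProjectionKernel 𝒦 K)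
    (h𝒦 : IsStarProjection 𝒦) (hrad : IsRadialKernel K) (hdiag : ∀ᵐ x, K x x = 1)
    {g : EuclideanSpace ℝ (Fin d) → ℝ≥0∞}
    (hg : ∀ᵐ p : EuclideanSpace ℝ (Fin d) × EuclideanSpace ℝ (Fin d) ∂volume.prod volume,
        ‖K p.1 p.2‖ₑ ^ 2 = g (p.1 - p.2)) :
    ∫⁻ z, g z = 1 := by
  obtain ⟨x, h1, h2, h3, h4, h5⟩ := ((Measure.ae_ae_of_ae_prod (hK.ae_eq_conj h𝒦 hrad)).and
    (hdiag.and (hK.reproducing_diag.and ((ae_lintegral_profile_eq hg).and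
      hK.memLp_section)))).exists
  rw [← h4]
  have hi := (memLp_two_iff_integrable_sq_norm h5.1).1 h5
  -- Hermitian symmetry turns `∫ K(x,y) K(y,x) dy = K(x,x) = 1` into the squared norm of the row.
  have e : ((∫ y, ‖K x y‖ ^ 2 : ℝ) : ℂ) = 1 := by
    rw [← h2, ← h3, ← integral_complex_ofReal]
    refine integral_congr_ae ?_
    filter_upwards [h1] with y hy
    rw [hy, Complex.mul_conj']
    simp
  have e' : ∫ y, ‖K x y‖ ^ 2 = 1 := by exact_mod_cast e
  have := ofReal_integral_eq_lintegral_ofReal hi (ae_of_all _ fun y => by positivity)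
  rw [e'] at this
  simpa [ENNReal.ofReal_pow] using this.symm

end Kernel

/-- Distinct members are at distance `√2`, so balls of radius `1/2` around them are disjoint.
Countability of bases is what allows sums over a basis to be exchanged with integrals and a.e.
statements. -/
theorem Orthonormal.countable_of_separableSpace {H ι : Type*} [NormedAddCommGroup H]
    [InnerProductSpace ℂ H] [TopologicalSpace.SeparableSpace H] {v : ι → H}
    (hv : Orthonormal ℂ v) : Countable ι := by
  refine Pairwise.countable_of_isOpen_disjoint (s := fun i => Metric.ball (v i) (1 / 2))
    (fun i j hij => ?_) (fun i => Metric.isOpen_ball) fun i => ⟨v i, by simp⟩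
  refine Metric.ball_disjoint_ball ?_
  have h1 : ‖v i - v j‖ ^ 2 = 2 := by
    rw [@norm_sub_sq ℂ, hv.2 hij, hv.1 i, hv.1 j]
    norm_num
  rw [dist_eq_norm]
  nlinarith [norm_nonneg (v i - v j)]

theorem L2.enorm_sq_eq_lintegral {α : Type*} [MeasurableSpace α] {μ : Measure α}
    (f : Lp ℂ 2 μ) : ‖f‖ₑ ^ 2 = ∫⁻ x, ‖f x‖ₑ ^ 2 ∂μ := by
  rw [Lp.enorm_def, eLpNorm_eq_lintegral_rpow_enorm_toReal two_ne_zero ENNReal.ofNat_ne_top]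
  rw [← ENNReal.rpow_natCast, ← ENNReal.rpow_mul]
  simp

/-! ### Hilbert-Schmidt norms, traces and eigenvalue sums -/

section Kernel

variable {d : ℕ} {𝒦 : L2 d →L[ℂ] L2 d}
  {K : EuclideanSpace ℝ (Fin d) → EuclideanSpace ℝ (Fin d) → ℂ}

/-- A square integrable function, restricted to `A`, represents an integral functional. -/
theorem exists_inner_eq_setIntegral {k : EuclideanSpace ℝ (Fin d) → ℂ} (hk : MemLp k 2 volume)
    {A : Set (EuclideanSpace ℝ (Fin d))} (hA : MeasurableSet A) :
    ∃ v : L2 d, ‖v‖ₑ ^ 2 = ∫⁻ y in A, ‖k y‖ₑ ^ 2 ∧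
      ∀ f : L2 d, ⟪v, f⟫_ℂ = ∫ y, k y * A.indicator f y := by
  have h1 : MemLp (A.indicator fun y => starRingEnd ℂ (k y)) 2 volume :=
    (hk.star).indicator hA
  refine ⟨h1.toLp, ?_, fun f => ?_⟩
  · rw [L2.enorm_sq_eq_lintegral, ← lintegral_indicator hA]
    refine lintegral_congr_ae ?_
    filter_upwards [h1.coeFn_toLp] with y hy
    rw [hy]
    by_cases hyA : y ∈ A <;> simp [hyA, ← ofReal_norm]
  · rw [L2.inner_def]
    refine integral_congr_ae ?_
    filter_upwards [h1.coeFn_toLp] with y hy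
    rw [hy]
    by_cases hyA : y ∈ A <;> simp [hyA, mul_comm]

theorem IsProjectionKernel.apply_restrictOp_ae_eq (hK : IsProjectionKernel 𝒦 K)
    {A : Set (EuclideanSpace ℝ (Fin d))} (hA : MeasurableSet A) (f : L2 d) :
    ∀ᵐ x, 𝒦 (restrictOp A f) x = ∫ y, K x y * A.indicator f y := by
  filter_upwards [hK.apply_ae_eq (restrictOp A f)] with x hx
  rw [hx]
  refine integral_congr_ae ?_
  filter_upwards [restrictOp_coeFn hA f] with y hy
  rw [hy]

/-- The Hilbert-Schmidt norm of `P_B 𝒦 P_A` in terms of the kernel. -/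
theorem IsProjectionKernel.tsum_setLIntegral_enorm_sq (hK : IsProjectionKernel 𝒦 K)
    {ι : Type*} [Countable ι] (b : HilbertBasis ι ℂ (L2 d))
    {A : Set (EuclideanSpace ℝ (Fin d))} (hA : MeasurableSet A)
    (B : Set (EuclideanSpace ℝ (Fin d))) :
    ∑' i, ∫⁻ x in B, ‖locN 𝒦 A (b i) x‖ₑ ^ 2 = ∫⁻ x in B, ∫⁻ y in A, ‖K x y‖ₑ ^ 2 := by
  rw [← lintegral_tsum fun i =>
    ((Lp.aestronglyMeasurable _).restrict.enorm.pow_const 2)]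
  refine lintegral_congr_ae (ae_restrict_of_ae ?_)
  filter_upwards [hK.memLp_section, ae_all_iff.2 fun i => hK.apply_restrictOp_ae_eq hA (b i)]
    with x hx hi
  -- For fixed `x`, the values at `x` of the images of the basis are the coefficients of the
  -- conjugated row cut off to `A`, and Parseval sums their squares.
  obtain ⟨v, hv, hv2⟩ := exists_inner_eq_setIntegral hx hA
  rw [← hv, ← b.tsum_enorm_inner_sq v]
  congr 1
  ext i
  rw [hv2, ← hi i]
  rfl

/-- Functions in the range of the projection, evaluated at a point, obey a Bessel inequality. -/
theorem IsProjectionKernel.ae_sum_norm_sq_le_one (hK : IsProjectionKernel 𝒦 K)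
    {g : EuclideanSpace ℝ (Fin d) → ℝ≥0∞}
    (hg : ∀ᵐ p : EuclideanSpace ℝ (Fin d) × EuclideanSpace ℝ (Fin d) ∂volume.prod volume,
        ‖K p.1 p.2‖ₑ ^ 2 = g (p.1 - p.2)) (hg1 : ∫⁻ z, g z = 1)
    {ι : Type*} {Φ : ι → L2 d} (hΦ : Orthonormal ℂ Φ) {W : L2 d →L[ℂ] L2 d} (hW : ‖W‖ ≤ 1)
    (s : Finset ι) (hfix : ∀ j ∈ s, 𝒦 (W (Φ j)) = W (Φ j)) :
    ∀ᵐ x, ∑ j ∈ s, ‖W (Φ j) x‖ ^ 2 ≤ 1 := by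
  have h1 : ∀ᵐ x, ∀ j ∈ s, W (Φ j) x = ∫ y, K x y * W (Φ j) y := by
    refine (Finset.eventually_all s).2 fun j hj => ?_
    have := hK.apply_ae_eq (W (Φ j))
    rwa [hfix j hj] at this
  filter_upwards [h1, hK.memLp_section, ae_lintegral_profile_eq hg] with x h1 h2 h3
  -- The vector `v` is the conjugated row at `x`. It has norm `1` and reproduces the value at `x` of
  -- every `W (Φ j)`, which `𝒦` fixes.
  obtain ⟨v, hv, hv2⟩ := exists_inner_eq_setIntegral h2 MeasurableSet.univ
  rw [Measure.restrict_univ, h3, hg1] at hv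
  have hv1 : ‖v‖ ^ 2 = 1 := by
    have := congrArg ENNReal.toReal hv
    simpa using this
  rw [← hv1]
  refine le_trans (Finset.sum_le_sum fun j hj => ?_)
    (sum_norm_inner_contraction_sq_le hΦ hW s v)
  rw [hv2, h1 j hj]
  simp

/-- Pythagoras for the splitting into `A` and `Aᶜ`, since `M_A = P_A N_A`. -/
theorem enorm_sq_locN_eq_add (f : L2 d) {A : Set (EuclideanSpace ℝ (Fin d))}
    (hA : MeasurableSet A) :
    ‖locN 𝒦 A f‖ₑ ^ 2 = ‖locM 𝒦 A f‖ₑ ^ 2 + ∫⁻ x in Aᶜ, ‖locN 𝒦 A f x‖ₑ ^ 2 := by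
  rw [L2.enorm_sq_eq_lintegral, L2.enorm_sq_eq_lintegral, ← lintegral_add_compl _ hA,
    ← lintegral_indicator hA]
  congr 1
  refine lintegral_congr_ae ?_
  filter_upwards [restrictOp_coeFn hA (locN 𝒦 A f)] with x hx
  change _ = ‖restrictOp A (locN 𝒦 A f) x‖ₑ ^ 2
  rw [hx]
  by_cases h : x ∈ A <;> simp [h]

theorem norm_sq_locN_eq_add (f : L2 d) {A : Set (EuclideanSpace ℝ (Fin d))}
    (hA : MeasurableSet A) :
    ENNReal.ofReal (‖locN 𝒦 A f‖ ^ 2 - ‖locM 𝒦 A f‖ ^ 2)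
      = ∫⁻ x in Aᶜ, ‖locN 𝒦 A f x‖ₑ ^ 2 := by
  rw [ENNReal.ofReal_sub _ (by positivity), ENNReal.ofReal_pow (norm_nonneg _),
    ENNReal.ofReal_pow (norm_nonneg _), ofReal_norm, ofReal_norm, enorm_sq_locN_eq_add f hA]
  exact ENNReal.add_sub_cancel_left (by simp)

theorem IsSpectralDecomposition.hasSum_norm_sq_locN (h𝒦 : IsStarProjection 𝒦)
    {A : Set (EuclideanSpace ℝ (Fin d))} (hA : MeasurableSet A) {μ : ℕ → ℝ} {Φ : ℕ → L2 d}
    (h : IsSpectralDecomposition (locM 𝒦 A) μ Φ) (f : L2 d) :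
    HasSum (fun j => μ j * ‖⟪Φ j, f⟫_ℂ‖ ^ 2) (‖locN 𝒦 A f‖ ^ 2) := by
  have := h.hasSum_inner f
  rw [← star_locN_mul_locN h𝒦 hA, inner_star_mul_self_apply] at this
  exact this

theorem IsSpectralDecomposition.eigenvalue_eq_norm_sq (h𝒦 : IsStarProjection 𝒦)
    {A : Set (EuclideanSpace ℝ (Fin d))} (hA : MeasurableSet A) {μ : ℕ → ℝ} {Φ : ℕ → L2 d}
    (h : IsSpectralDecomposition (locM 𝒦 A) μ Φ) (j : ℕ) : μ j = ‖locN 𝒦 A (Φ j)‖ ^ 2 := by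
  have h1 := inner_star_mul_self_apply (locN 𝒦 A) (Φ j)
  rw [star_locN_mul_locN h𝒦 hA, h.apply_eigenvector, inner_smul_right,
    inner_self_eq_norm_sq_to_K, h.orthonormal.norm_eq_one] at h1
  simp only [map_one, one_pow, mul_one] at h1
  exact_mod_cast h1

theorem norm_restrictOp_le {A : Set (EuclideanSpace ℝ (Fin d))}
    (hA : MeasurableSet A) (f : L2 d) : ‖restrictOp A f‖ ≤ ‖f‖ := by
  apply Lp.norm_le_norm_of_ae_le
  filter_upwards [restrictOp_coeFn hA f] with x h1
  rw [h1]
  exact norm_indicator_le_norm_self _ _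

theorem norm_locN_le (h𝒦 : IsStarProjection 𝒦) {A : Set (EuclideanSpace ℝ (Fin d))}
    (hA : MeasurableSet A) (f : L2 d) : ‖locN 𝒦 A f‖ ≤ ‖f‖ := by
  have h1 : ‖𝒦‖ ≤ 1 := h𝒦.norm_le
  calc ‖𝒦 (restrictOp A f)‖ ≤ ‖𝒦‖ * ‖restrictOp A f‖ := 𝒦.le_opNorm _
    _ ≤ 1 * ‖f‖ := mul_le_mul h1 (norm_restrictOp_le hA f) (norm_nonneg _) zero_le_one
    _ = ‖f‖ := one_mul _

theorem IsSpectralDecomposition.eigenvalue_le_one (h𝒦 : IsStarProjection 𝒦)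
    {A : Set (EuclideanSpace ℝ (Fin d))} (hA : MeasurableSet A) {μ : ℕ → ℝ} {Φ : ℕ → L2 d}
    (h : IsSpectralDecomposition (locM 𝒦 A) μ Φ) (j : ℕ) : μ j ≤ 1 := by
  rw [h.eigenvalue_eq_norm_sq h𝒦 hA]
  have := norm_locN_le h𝒦 hA (Φ j)
  rw [h.orthonormal.norm_eq_one] at this
  exact pow_le_one₀ (norm_nonneg _) this

instance countable_basisSet_L2 : Countable (basisSet (L2 d)) :=
  have : Fact ((2 : ℝ≥0∞) ≠ ∞) := ⟨ENNReal.ofNat_ne_top⟩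
  (someHilbertBasis (L2 d)).orthonormal.countable_of_separableSpace

/-- The diagonal sum of `M_A` in an orthonormal basis is the volume of `A`. -/
theorem IsProjectionKernel.tsum_norm_sq_locN (hK : IsProjectionKernel 𝒦 K)
    {g : EuclideanSpace ℝ (Fin d) → ℝ≥0∞}
    (hg : ∀ᵐ p : EuclideanSpace ℝ (Fin d) × EuclideanSpace ℝ (Fin d) ∂volume.prod volume,
        ‖K p.1 p.2‖ₑ ^ 2 = g (p.2 - p.1)) (hg1 : ∫⁻ z, g z = 1)
    {A : Set (EuclideanSpace ℝ (Fin d))} (hA : MeasurableSet A) :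
    ∑' i, ENNReal.ofReal (‖locN 𝒦 A (someHilbertBasis (L2 d) i)‖ ^ 2) = volume A := by
  have h1 := hK.tsum_setLIntegral_enorm_sq (someHilbertBasis (L2 d)) hA Set.univ
  simp only [Measure.restrict_univ] at h1
  simp_rw [← L2.enorm_sq_eq_lintegral] at h1
  simp_rw [ENNReal.ofReal_pow (norm_nonneg _), ofReal_norm]
  have hle : (volume.prod (volume.restrict A)) ≤
      (volume.prod volume : Measure (EuclideanSpace ℝ (Fin d) × EuclideanSpace ℝ (Fin d))) := by
    nth_rewrite 1 [← Measure.restrict_univ (μ := volume)]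
    rw [Measure.prod_restrict]
    exact Measure.restrict_le_self
  rw [h1, lintegral_lintegral_swap ((hK.aestronglyMeasurable.enorm.pow_const 2).mono_measure hle),
    ← setLIntegral_one]
  refine lintegral_congr_ae (ae_restrict_of_ae ?_)
  have hsw := (Measure.measurePreserving_swap
    (μ := (volume : Measure (EuclideanSpace ℝ (Fin d)))) (ν := volume)).quasiMeasurePreserving.ae hg
  filter_upwards [Measure.ae_ae_of_ae_prod hsw] with y hy
  simp only [Prod.fst_swap, Prod.snd_swap] at hy
  rw [lintegral_congr_ae hy, lintegral_sub_left_eq_self, hg1]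

theorem IsProjectionKernel.tsum_eigenvalues_eq_volume (hK : IsProjectionKernel 𝒦 K)
    (h𝒦 : IsStarProjection 𝒦) {g : EuclideanSpace ℝ (Fin d) → ℝ≥0∞}
    (hg : ∀ᵐ p : EuclideanSpace ℝ (Fin d) × EuclideanSpace ℝ (Fin d) ∂volume.prod volume,
        ‖K p.1 p.2‖ₑ ^ 2 = g (p.2 - p.1)) (hg1 : ∫⁻ z, g z = 1)
    {A : Set (EuclideanSpace ℝ (Fin d))} (hA : MeasurableSet A) {μ : ℕ → ℝ} {Φ : ℕ → L2 d}
    (h : IsSpectralDecomposition (locM 𝒦 A) μ Φ) :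
    ∑' j, ENNReal.ofReal (μ j) = volume A := by
  rw [← hK.tsum_norm_sq_locN hg hg1 hA]
  exact (tsum_quadraticForm_eq_tsum_weights _ h.orthonormal h.nonneg
    (q := fun f => ‖locN 𝒦 A f‖ ^ 2) (h.hasSum_norm_sq_locN h𝒦 hA)).symm

theorem IsProjectionKernel.re_opTrace_locM (hK : IsProjectionKernel 𝒦 K)
    (h𝒦 : IsStarProjection 𝒦) {g : EuclideanSpace ℝ (Fin d) → ℝ≥0∞}
    (hg : ∀ᵐ p : EuclideanSpace ℝ (Fin d) × EuclideanSpace ℝ (Fin d) ∂volume.prod volume,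
        ‖K p.1 p.2‖ₑ ^ 2 = g (p.2 - p.1)) (hg1 : ∫⁻ z, g z = 1)
    {A : Set (EuclideanSpace ℝ (Fin d))} (hA : MeasurableSet A) :
    (opTrace (locM 𝒦 A)).re = volume.real A := by
  rw [opTrace, ← star_locN_mul_locN h𝒦 hA]
  simp_rw [inner_star_mul_self_apply]
  rw [← Complex.ofReal_tsum, Complex.ofReal_re, Measure.real,
    ← hK.tsum_norm_sq_locN hg hg1 hA, ENNReal.tsum_toReal_eq (fun i => ENNReal.ofReal_ne_top)]
  congr 1
  ext i
  rw [ENNReal.toReal_ofReal (by positivity)]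

/-- `∑ μ_j (1 - μ_j)` measures the interaction of `A` with its complement. -/
theorem IsProjectionKernel.tsum_eigenvalues_mul_one_sub (hK : IsProjectionKernel 𝒦 K)
    (h𝒦 : IsStarProjection 𝒦) {g : EuclideanSpace ℝ (Fin d) → ℝ≥0∞}
    (hg : ∀ᵐ p : EuclideanSpace ℝ (Fin d) × EuclideanSpace ℝ (Fin d) ∂volume.prod volume,
        ‖K p.1 p.2‖ₑ ^ 2 = g (p.2 - p.1))
    {A : Set (EuclideanSpace ℝ (Fin d))} (hA : MeasurableSet A) {μ : ℕ → ℝ} {Φ : ℕ → L2 d}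
    (h : IsSpectralDecomposition (locM 𝒦 A) μ Φ) :
    ∑' j, ENNReal.ofReal (μ j * (1 - μ j)) = ∫⁻ y in A, ∫⁻ x in Aᶜ, g (y - x) := by
  have hw : ∀ j, 0 ≤ μ j * (1 - μ j) := fun j =>
    mul_nonneg (h.nonneg j) (sub_nonneg.2 (h.eigenvalue_le_one h𝒦 hA j))
  -- The weights `μ_j - μ_j²` diagonalize `‖N f‖² - ‖M f‖²`, the mass of `N f` outside `A`. Its
  -- diagonal sum is the squared Hilbert-Schmidt norm of `P_{Aᶜ} 𝒦 P_A`.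
  rw [← tsum_quadraticForm_eq_tsum_weights (someHilbertBasis (L2 d)) h.orthonormal hw
    (q := fun f => ‖locN 𝒦 A f‖ ^ 2 - ‖locM 𝒦 A f‖ ^ 2) fun f =>
      ((h.hasSum_norm_sq_locN h𝒦 hA f).sub (h.hasSum_norm_sq f)).congr_terms fun j => by ring]
  simp_rw [norm_sq_locN_eq_add _ hA]
  rw [hK.tsum_setLIntegral_enorm_sq (someHilbertBasis (L2 d)) hA]
  have hle : ((volume.restrict Aᶜ).prod (volume.restrict A)) ≤
      (volume.prod volume : Measure (EuclideanSpace ℝ (Fin d) × EuclideanSpace ℝ (Fin d))) := by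
    rw [Measure.prod_restrict]
    exact Measure.restrict_le_self
  rw [lintegral_lintegral_swap ((hK.aestronglyMeasurable.enorm.pow_const 2).mono_measure hle)]
  refine lintegral_congr_ae (ae_restrict_of_ae ?_)
  have hsw := (Measure.measurePreserving_swap
    (μ := (volume : Measure (EuclideanSpace ℝ (Fin d)))) (ν := volume)).quasiMeasurePreserving.ae hg
  filter_upwards [Measure.ae_ae_of_ae_prod hsw] with y hy
  simp only [Prod.fst_swap, Prod.snd_swap] at hy
  exact lintegral_congr_ae (ae_restrict_of_ae hy)

end Kernel

/-! ### The `L¹` estimate for the accumulated spectrogram -/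

section Spectrogram

variable {d : ℕ} {𝒦 : L2 d →L[ℂ] L2 d}
  {K : EuclideanSpace ℝ (Fin d) → EuclideanSpace ℝ (Fin d) → ℂ}

theorem L2.integrable_norm_sq {α : Type*} [MeasurableSpace α] {μ : Measure α}
    (f : Lp ℂ 2 μ) : Integrable (fun x => ‖f x‖ ^ 2) μ :=
  (memLp_two_iff_integrable_sq_norm (Lp.aestronglyMeasurable f)).1 (Lp.memLp f)

theorem L2.integral_norm_sq {α : Type*} [MeasurableSpace α] {μ : Measure α}
    (f : Lp ℂ 2 μ) : ∫ x, ‖f x‖ ^ 2 ∂μ = ‖f‖ ^ 2 := by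
  have h := ofReal_integral_eq_lintegral_ofReal (L2.integrable_norm_sq f)
    (ae_of_all _ fun y => by positivity)
  simp_rw [ENNReal.ofReal_pow (norm_nonneg _), ofReal_norm] at h
  rw [← L2.enorm_sq_eq_lintegral, ← ofReal_norm, ← ENNReal.ofReal_pow (norm_nonneg _)] at h
  exact (ENNReal.ofReal_eq_ofReal_iff (integral_nonneg fun y => by positivity)
    (by positivity)).1 h

theorem setIntegral_norm_sq_eq_restrictOp (f : L2 d) {A : Set (EuclideanSpace ℝ (Fin d))}
    (hA : MeasurableSet A) : ∫ x in A, ‖f x‖ ^ 2 = ‖restrictOp A f‖ ^ 2 := by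
  rw [← L2.integral_norm_sq, ← integral_indicator hA]
  refine integral_congr_ae ?_
  filter_upwards [restrictOp_coeFn hA f] with x hx
  rw [hx]
  by_cases h : x ∈ A <;> simp [h]

theorem IsSpectralDecomposition.polarFactor_eq (h𝒦 : IsStarProjection 𝒦)
    {A : Set (EuclideanSpace ℝ (Fin d))} (hA : MeasurableSet A) {μ : ℕ → ℝ} {Φ : ℕ → L2 d}
    (h : IsSpectralDecomposition (locM 𝒦 A) μ Φ) (j : ℕ) :
    polarFactor (locN 𝒦 A) (Φ j) = (((√(μ j))⁻¹ : ℝ) : ℂ) • locN 𝒦 A (Φ j) := by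
  rcases (h.nonneg j).eq_or_lt with h0 | h0
  -- For a zero eigenvalue both sides vanish, because `N Φ_j = 0`; no case distinction is needed
  -- afterwards.
  · have h1 := h.eigenvalue_eq_norm_sq h𝒦 hA j
    rw [← h0] at h1
    have h2 : locN 𝒦 A (Φ j) = 0 := by
      simpa using h1.symm
    rw [polarFactor_eq_zero _ _ h2, h2, smul_zero]
  · refine polarFactor_apply_eigenvector _ h0 ?_
    rw [star_locN_mul_locN h𝒦 hA, h.apply_eigenvector]

theorem IsSpectralDecomposition.apply_polarFactor (h𝒦 : IsStarProjection 𝒦)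
    {A : Set (EuclideanSpace ℝ (Fin d))} (hA : MeasurableSet A) {μ : ℕ → ℝ} {Φ : ℕ → L2 d}
    (h : IsSpectralDecomposition (locM 𝒦 A) μ Φ) (j : ℕ) :
    𝒦 (polarFactor (locN 𝒦 A) (Φ j)) = polarFactor (locN 𝒦 A) (Φ j) := by
  have hid : ∀ f, 𝒦 (𝒦 f) = 𝒦 f := fun f => DFunLike.congr_fun h𝒦.isIdempotentElem.eq f
  rw [h.polarFactor_eq h𝒦 hA, map_smul]
  congr 1
  exact hid _

/-- Restricting `N Φ_j` to `A` gives `M Φ_j = μ_j Φ_j`, so the mass is `μ_j² / μ_j`. -/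
theorem IsSpectralDecomposition.setIntegral_polarFactor (h𝒦 : IsStarProjection 𝒦)
    {A : Set (EuclideanSpace ℝ (Fin d))} (hA : MeasurableSet A) {μ : ℕ → ℝ} {Φ : ℕ → L2 d}
    (h : IsSpectralDecomposition (locM 𝒦 A) μ Φ) (j : ℕ) :
    ∫ x in A, ‖polarFactor (locN 𝒦 A) (Φ j) x‖ ^ 2 = μ j := by
  have h1 : restrictOp A (locN 𝒦 A (Φ j)) = (μ j : ℂ) • Φ j := h.apply_eigenvector j
  rw [setIntegral_norm_sq_eq_restrictOp _ hA, h.polarFactor_eq h𝒦 hA, map_smul, h1, smul_smul,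
    norm_smul, h.orthonormal.norm_eq_one, mul_one, ← Complex.ofReal_mul, Complex.norm_real,
    Real.norm_eq_abs, sq_abs, mul_pow, inv_pow, Real.sq_sqrt (h.nonneg j)]
  rcases eq_or_ne (μ j) 0 with h0 | h0
  · simp [h0]
  · field_simp

/-- Only an inequality, since `W Φ_j = 0` rather than a unit vector when `μ_j = 0`. -/
theorem IsSpectralDecomposition.setIntegral_compl_polarFactor_le (h𝒦 : IsStarProjection 𝒦)
    {A : Set (EuclideanSpace ℝ (Fin d))} (hA : MeasurableSet A) {μ : ℕ → ℝ} {Φ : ℕ → L2 d}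
    (h : IsSpectralDecomposition (locM 𝒦 A) μ Φ) (j : ℕ) :
    ∫ x in Aᶜ, ‖polarFactor (locN 𝒦 A) (Φ j) x‖ ^ 2 ≤ 1 - μ j := by
  have h1 := integral_add_compl hA (L2.integrable_norm_sq (polarFactor (locN 𝒦 A) (Φ j)))
  rw [h.setIntegral_polarFactor h𝒦 hA, L2.integral_norm_sq] at h1
  have h2 : ‖polarFactor (locN 𝒦 A) (Φ j)‖ ≤ 1 := by
    refine (ContinuousLinearMap.le_opNorm _ _).trans ?_
    rw [h.orthonormal.norm_eq_one, mul_one]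
    exact norm_polarFactor_le _
  have h3 := pow_le_one₀ (n := 2) (norm_nonneg _) h2
  linarith

theorem integrable_accumulatedSpectrogram (𝒦 : L2 d →L[ℂ] L2 d)
    (A : Set (EuclideanSpace ℝ (Fin d))) (Φ : ℕ → L2 d) :
    Integrable (accumulatedSpectrogram 𝒦 A Φ) volume :=
  integrable_finsetSum _ fun _ _ => L2.integrable_norm_sq _

/-- The `L¹` distance between the accumulated spectrogram and the indicator function is controlled
by the interaction of `A` with its complement. -/
theorem IsProjectionKernel.eLpNorm_accumulatedSpectrogram_sub_le (hK : IsProjectionKernel 𝒦 K)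
    (h𝒦 : IsStarProjection 𝒦) {g : EuclideanSpace ℝ (Fin d) → ℝ≥0∞}
    (hg : ∀ᵐ p : EuclideanSpace ℝ (Fin d) × EuclideanSpace ℝ (Fin d) ∂volume.prod volume,
        ‖K p.1 p.2‖ₑ ^ 2 = g (p.1 - p.2))
    (hg' : ∀ᵐ p : EuclideanSpace ℝ (Fin d) × EuclideanSpace ℝ (Fin d) ∂volume.prod volume,
        ‖K p.1 p.2‖ₑ ^ 2 = g (p.2 - p.1)) (hg1 : ∫⁻ z, g z = 1)
    {A : Set (EuclideanSpace ℝ (Fin d))} (hA : MeasurableSet A) (hAfin : volume A ≠ ∞)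
    {μ : ℕ → ℝ} {Φ : ℕ → L2 d} (h : IsSpectralDecomposition (locM 𝒦 A) μ Φ) :
    eLpNorm (fun x => accumulatedSpectrogram 𝒦 A Φ x - A.indicator (fun _ => (1 : ℝ)) x) 1 volume
      ≤ 1 + 2 * ∫⁻ y in A, ∫⁻ x in Aᶜ, g (y - x) := by
  set ρ := accumulatedSpectrogram 𝒦 A Φ with hρ
  set n := numEigen 𝒦 A with hn
  have hρint : Integrable ρ volume := integrable_accumulatedSpectrogram 𝒦 A Φ
  have hρ0 : ∀ x, 0 ≤ ρ x := fun x => Finset.sum_nonneg fun j _ => by positivity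
  have hρ1 : ∀ᵐ x, ρ x ≤ 1 := hK.ae_sum_norm_sq_le_one hg hg1 h.orthonormal
    (norm_polarFactor_le _) _ fun j _ => h.apply_polarFactor h𝒦 hA j
  have hle1 := h.eigenvalue_le_one h𝒦 hA
  have hsumE := hK.tsum_eigenvalues_eq_volume h𝒦 hg' hg1 hA h
  have hs : Summable μ := by
    have := ENNReal.summable_toReal (hsumE.trans_ne hAfin)
    exact this.congr fun j => by simp [h.nonneg j]
  have hsum : ∑' j, μ j = volume.real A := by
    rw [Measure.real, ← hsumE, ENNReal.tsum_toReal_eq (fun i => ENNReal.ofReal_ne_top)]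
    exact tsum_congr fun j => by simp [h.nonneg j]
  have htr := hK.re_opTrace_locM h𝒦 hg' hg1 hA
  have hn1 : volume.real A ≤ n := by rw [← htr]; exact Nat.le_ceil _
  -- Rounding the trace up costs at most `1`: this is the additive constant of the final bound.
  have hn2 : (n : ℝ) ≤ volume.real A + 1 := by
    rw [← htr]
    refine (Nat.ceil_lt_add_one ?_).le
    rw [htr]
    positivity
  have htail := tsum_tail_le_tsum_mul_one_sub h.antitone h.nonneg hle1 hs (hsum.trans_le hn1)
  have hsplit := hs.sum_add_tsum_nat_add n
  have hin : ∫ x in A, ρ x = ∑ j ∈ Finset.range n, μ j := by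
    rw [hρ]
    unfold accumulatedSpectrogram
    rw [integral_finsetSum _ fun j _ => (L2.integrable_norm_sq _).integrableOn]
    exact Finset.sum_congr rfl fun j _ => h.setIntegral_polarFactor h𝒦 hA j
  have hout : ∫ x in Aᶜ, ρ x ≤ n - ∑ j ∈ Finset.range n, μ j := by
    rw [hρ]
    unfold accumulatedSpectrogram
    rw [integral_finsetSum _ fun j _ => (L2.integrable_norm_sq _).integrableOn]
    refine (Finset.sum_le_sum fun j _ => h.setIntegral_compl_polarFactor_le h𝒦 hA j).trans ?_
    simp [Finset.sum_sub_distrib, hn]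
  have hone : Integrable (A.indicator fun _ => (1 : ℝ)) volume :=
    (integrable_indicator_iff hA).2 (integrableOn_const hAfin)
  have hdint : Integrable (fun x => ρ x - A.indicator (fun _ => (1 : ℝ)) x) volume :=
    hρint.sub hone
  have hnorm : ∫ x, ‖ρ x - A.indicator (fun _ => (1 : ℝ)) x‖
      ≤ 1 + 2 * ∑' j, μ j * (1 - μ j) := by
    rw [← integral_add_compl hA hdint.norm]
    have e1 : ∫ x in A, ‖ρ x - A.indicator (fun _ => (1 : ℝ)) x‖
        = volume.real A - ∑ j ∈ Finset.range n, μ j := by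
      rw [← hin]
      have : ∫ x in A, ((1 : ℝ) - ρ x) = volume.real A - ∫ x in A, ρ x := by
        rw [integral_sub (integrableOn_const (C := (1 : ℝ)) hAfin).integrable
          hρint.integrableOn.integrable]
        simp
      rw [← this]
      refine setIntegral_congr_ae hA ?_
      filter_upwards [hρ1] with x hx hxA
      rw [Set.indicator_of_mem hxA, norm_sub_rev, Real.norm_of_nonneg (by linarith)]
    have e2 : ∫ x in Aᶜ, ‖ρ x - A.indicator (fun _ => (1 : ℝ)) x‖ = ∫ x in Aᶜ, ρ x := by
      refine setIntegral_congr_fun hA.compl fun x hxA => ?_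
      rw [Set.indicator_of_notMem hxA, sub_zero, Real.norm_of_nonneg (hρ0 x)]
    rw [e1, e2]
    linarith
  have hw : ∀ j, 0 ≤ μ j * (1 - μ j) := fun j =>
    mul_nonneg (h.nonneg j) (sub_nonneg.2 (hle1 j))
  have hws : Summable fun j => μ j * (1 - μ j) :=
    Summable.of_nonneg_of_le hw
      (fun j => mul_le_of_le_one_right (h.nonneg j) (by linarith [h.nonneg j])) hs
  rw [eLpNorm_one_eq_lintegral_enorm, ← hK.tsum_eigenvalues_mul_one_sub h𝒦 hg' hA h,
    ← ENNReal.ofReal_tsum_of_nonneg hw hws, ← ofReal_integral_norm_eq_lintegral_enorm hdint]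
  refine (ENNReal.ofReal_le_ofReal hnorm).trans_eq ?_
  rw [ENNReal.ofReal_add zero_le_one (mul_nonneg zero_le_two (tsum_nonneg hw)),
    ENNReal.ofReal_mul zero_le_two]
  simp

end Spectrogram

/-! ### Dilations and the vanishing of the rescaled interaction -/

section Scaling

variable {d : ℕ}

theorem lintegral_comp_smul_eq {R : ℝ} (hR : 0 < R) (f : EuclideanSpace ℝ (Fin d) → ℝ≥0∞) :
    ∫⁻ x, f (R • x) = (ENNReal.ofReal (R ^ d))⁻¹ * ∫⁻ x, f x := by
  have h1 := lintegral_map_equiv (μ := volume) f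
    (Homeomorph.smul (isUnit_iff_ne_zero.2 hR.ne').unit :
      EuclideanSpace ℝ (Fin d) ≃ₜ EuclideanSpace ℝ (Fin d)).toMeasurableEquiv
  have h2 : (∫⁻ x, f x ∂(Measure.map (R • · : EuclideanSpace ℝ (Fin d) → _) volume))
      = ∫⁻ x, f (R • x) := h1
  rw [← h2, Measure.map_addHaar_smul _ hR.ne', lintegral_smul_measure, finrank_euclideanSpace,
    Fintype.card_fin, abs_of_nonneg (by positivity), ENNReal.ofReal_inv_of_pos (by positivity),
    smul_eq_mul]

theorem indicator_smul_set_apply {M : Type*} [Zero M] {R : ℝ} (hR : 0 < R)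
    (s : Set (EuclideanSpace ℝ (Fin d))) (c : M) (x : EuclideanSpace ℝ (Fin d)) :
    (R • s).indicator (fun _ => c) (R • x) = s.indicator (fun _ => c) x := by
  have : R • x ∈ R • s ↔ x ∈ s := Set.smul_mem_smul_set_iff₀ hR.ne' s x
  by_cases h : x ∈ s
  · rw [Set.indicator_of_mem h, Set.indicator_of_mem (this.2 h)]
  · rw [Set.indicator_of_notMem h, Set.indicator_of_notMem (mt this.1 h)]

/-- Substitute `y = R v`, which absorbs the factor `R^d`, and then `x = R v - z`. The dependence on
`R` moves from `g` into the indicator, ready for dominated convergence. -/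
theorem lintegral_interaction_smul {R : ℝ} (hR : 0 < R) {s : Set (EuclideanSpace ℝ (Fin d))}
    (hs : MeasurableSet s) (g : EuclideanSpace ℝ (Fin d) → ℝ≥0∞) :
    (ENNReal.ofReal (R ^ d))⁻¹ * ∫⁻ y in R • s, ∫⁻ x in (R • s)ᶜ, g (y - x)
      = ∫⁻ v in s, ∫⁻ z, sᶜ.indicator (fun _ => g z) (v - R⁻¹ • z) := by
  have hRs : MeasurableSet (R • s) := hs.const_smul₀ R
  rw [← lintegral_indicator hRs, ← lintegral_comp_smul_eq hR, ← lintegral_indicator hs]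
  refine lintegral_congr fun v => ?_
  have hv : R • v ∈ R • s ↔ v ∈ s := Set.smul_mem_smul_set_iff₀ hR.ne' s v
  by_cases h : v ∈ s
  · rw [Set.indicator_of_mem h, Set.indicator_of_mem (hv.2 h), ← lintegral_indicator hRs.compl,
      ← lintegral_sub_left_eq_self _ (R • v)]
    refine lintegral_congr fun z => ?_
    have e : R • v - z = R • (v - R⁻¹ • z) := by
      rw [smul_sub, smul_inv_smul₀ hR.ne']
    have hz : R • v - z ∈ R • s ↔ v - R⁻¹ • z ∈ s := by
      rw [e]; exact Set.smul_mem_smul_set_iff₀ hR.ne' s _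
    by_cases h' : v - R⁻¹ • z ∈ s
    · rw [Set.indicator_of_notMem (by simpa using hz.2 h'),
        Set.indicator_of_notMem (by simpa using h')]
    · rw [Set.indicator_of_mem (by simpa using mt hz.1 h'),
        Set.indicator_of_mem (by simpa using h'), sub_sub_cancel]
  · rw [Set.indicator_of_notMem h, Set.indicator_of_notMem (mt hv.1 h)]

/-- The integrand is dominated by `g z`, of integral `|s| ∫ g`. For `v` in the open set `s` and
fixed `z`, the point `v - z/R` is eventually in `s`, where the indicator vanishes; the boundary of
`s` plays no role. -/
theorem tendsto_lintegral_interaction {s : Set (EuclideanSpace ℝ (Fin d))} (hs : IsOpen s)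
    (hsfin : volume s ≠ ∞) {g : EuclideanSpace ℝ (Fin d) → ℝ≥0∞} (hgm : Measurable g)
    (hg : ∫⁻ z, g z ≠ ∞) :
    Tendsto (fun R : ℝ => ∫⁻ v in s, ∫⁻ z, sᶜ.indicator (fun _ => g z) (v - R⁻¹ • z)) atTop
      (𝓝 0) := by
  have hmeas : ∀ R : ℝ, Measurable
      fun p : EuclideanSpace ℝ (Fin d) × EuclideanSpace ℝ (Fin d) =>
        sᶜ.indicator (fun _ => g p.2) (p.1 - R⁻¹ • p.2) := by
    intro R
    have hm : MeasurableSet {p : EuclideanSpace ℝ (Fin d) × EuclideanSpace ℝ (Fin d) |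
        p.1 - R⁻¹ • p.2 ∈ sᶜ} :=
      (show Measurable fun p : EuclideanSpace ℝ (Fin d) × EuclideanSpace ℝ (Fin d) =>
        p.1 - R⁻¹ • p.2 by fun_prop) hs.measurableSet.compl
    exact (hgm.comp measurable_snd).indicator hm
  have hprod : ∀ R : ℝ, ∫⁻ v in s, ∫⁻ z, sᶜ.indicator (fun _ => g z) (v - R⁻¹ • z)
      = ∫⁻ p, sᶜ.indicator (fun _ => g p.2) (p.1 - R⁻¹ • p.2)
          ∂(volume.restrict s).prod volume := fun R =>
    (lintegral_prod _ (hmeas R).aemeasurable).symm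
  simp_rw [hprod]
  rw [← lintegral_zero (μ := ((volume : Measure (EuclideanSpace ℝ (Fin d))).restrict s).prod
    (volume : Measure (EuclideanSpace ℝ (Fin d))))]
  refine tendsto_lintegral_filter_of_dominated_convergence (fun p => g p.2)
    (Eventually.of_forall hmeas) (Eventually.of_forall fun R => ae_of_all _ fun p =>
      Set.indicator_apply_le fun _ => le_rfl) ?_ ?_
  · rw [lintegral_prod (fun p => g p.2) (hgm.comp measurable_snd).aemeasurable]
    simpa using ENNReal.mul_ne_top hg hsfin
  · have hae : ∀ᵐ p ∂((volume : Measure (EuclideanSpace ℝ (Fin d))).restrict s).prod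
        (volume : Measure (EuclideanSpace ℝ (Fin d))), p.1 ∈ s :=
      Measure.quasiMeasurePreserving_fst.ae (ae_restrict_mem hs.measurableSet)
    filter_upwards [hae] with p hp
    have hlim : Tendsto (fun R : ℝ => p.1 - R⁻¹ • p.2) atTop (𝓝 p.1) := by
      have := (tendsto_const_nhds (x := p.1)).sub
        ((tendsto_inv_atTop_zero (𝕜 := ℝ)).smul_const p.2)
      simpa using this
    refine tendsto_const_nhds.congr' ?_
    filter_upwards [hlim (hs.mem_nhds hp)] with R hR
    exact (Set.indicator_of_notMem (by simpa using hR) _).symm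

end Scaling

/-! ### The limit theorem -/

theorem corollary1p3 {d : ℕ} (hd : 0 < d)
    (𝒦 : L2 d →L[ℂ] L2 d) (h𝒦 : IsStarProjection 𝒦) (hloc : IsLocallyTraceClass 𝒦)
    (K : EuclideanSpace ℝ (Fin d) → EuclideanSpace ℝ (Fin d) → ℂ)
    (hK : IsProjectionKernel 𝒦 K) (hrad : IsRadialKernel K) (hdiag : ∀ᵐ x, K x x = 1)
    (Λ : Set (EuclideanSpace ℝ (Fin d))) (hΛ : IsOpen Λ) (hΛc : IsCompact (closure Λ))
    (μ : ℝ → ℕ → ℝ) (Φ : ℝ → ℕ → L2 d)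
    (hΦ : ∀ R : ℝ, 0 < R → IsSpectralDecomposition (locM 𝒦 (R • Λ)) (μ R) (Φ R)) :
    (∀ R : ℝ, 0 < R →
      Integrable (fun x => accumulatedSpectrogram 𝒦 (R • Λ) (Φ R) (R • x)) volume) ∧
    Tendsto (fun R : ℝ =>
        eLpNorm (fun x => accumulatedSpectrogram 𝒦 (R • Λ) (Φ R) (R • x)
          - Λ.indicator (fun _ => (1 : ℝ)) x) 1 volume)
      atTop (𝓝 0) := by
  refine ⟨fun R hR => (integrable_accumulatedSpectrogram 𝒦 _ _).comp_smul hR.ne', ?_⟩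
  obtain ⟨g, hgm, hgfin, hg, hg'⟩ := hrad.exists_measurable_profile hK
  have hg1 := hK.lintegral_profile_eq_one h𝒦 hrad hdiag hg
  have hΛfin : volume Λ ≠ ∞ :=
    measure_ne_top_of_subset subset_closure hΛc.measure_lt_top.ne
  have hbound : ∀ R : ℝ, 0 < R →
      eLpNorm (fun x => accumulatedSpectrogram 𝒦 (R • Λ) (Φ R) (R • x)
          - Λ.indicator (fun _ => (1 : ℝ)) x) 1 volume
        ≤ (ENNReal.ofReal (R ^ d))⁻¹
          + 2 * ∫⁻ v in Λ, ∫⁻ z, Λᶜ.indicator (fun _ => g z) (v - R⁻¹ • z) := by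
    intro R hR
    have hRfin : volume (R • Λ) ≠ ∞ := by
      rw [Measure.addHaar_smul]
      exact ENNReal.mul_ne_top ENNReal.ofReal_ne_top hΛfin
    have h1 := hK.eLpNorm_accumulatedSpectrogram_sub_le h𝒦 hg hg' hg1
      (hΛ.measurableSet.const_smul₀ R) hRfin (hΦ R hR)
    rw [eLpNorm_one_eq_lintegral_enorm] at h1 ⊢
    have h2 := lintegral_comp_smul_eq hR fun x =>
      ‖accumulatedSpectrogram 𝒦 (R • Λ) (Φ R) x - (R • Λ).indicator (fun _ => (1 : ℝ)) x‖ₑ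
    simp only [indicator_smul_set_apply hR] at h2
    rw [h2, ← lintegral_interaction_smul hR hΛ.measurableSet]
    refine (mul_le_mul_right h1 _).trans_eq ?_
    ring
  -- The rounding error `1` becomes `R^{-d}` after rescaling, and vanishes because `d > 0`.
  have hlim1 : Tendsto (fun R : ℝ => (ENNReal.ofReal (R ^ d))⁻¹) atTop (𝓝 0) :=
    ENNReal.inv_top ▸ tendsto_inv_iff.2
      (ENNReal.tendsto_ofReal_atTop.comp (tendsto_pow_atTop hd.ne'))
  have hlim2 := ENNReal.Tendsto.const_mul (a := 2)
    (tendsto_lintegral_interaction hΛ hΛfin hgm hgfin) (Or.inr ENNReal.ofNat_ne_top)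
  have hlim := hlim1.add hlim2
  rw [mul_zero, add_zero] at hlim
  refine tendsto_of_tendsto_of_tendsto_of_le_of_le' tendsto_const_nhds hlim
    (Eventually.of_forall fun _ => zero_le) ?_
  filter_upwards [eventually_gt_atTop 0] with R hR
  exact hbound R hR
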